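/- Fix finitely many packet fields $f_1,\dots,f_k$, each with a finite set of values. NetKAT predicates are $a,b ::= 1 \mid 0 \mid f=n \mid a+b \mid a\cdot b \mid \neg a$, and NetKAT policies are $p,q ::= a \mid f\leftarrow n \mid p+q \mid p\cdot q \mid p^* \mid \mathbf{dup}$, where $f$ is a field and $n$ a value of $f$. Write $p\le q$ for $p+q\equiv q$, $q^0=1$ and $q^{n+1}=q\cdot q^{n}$. Let $\vdash e\equiv e'$ mean that the equation $e\equiv e'$ between policies is derivable, by the rules of equational logic (reflexivity, symmetry, transitivity, congruence for all operations), from the NetKAT axioms, namely: - for all policies $p,q,r$: $p+(q+r)\equiv(p+q)+r$; $p+q\equiv q+p$; $p+0\equiv p$; $p+p\equiv p$; $p\cdot(q\cdot r)\equiv(p\cdot q)\cdot r$; $1\cdot p\equiv p$; $p\cdot 1\equiv p$; $p\cdot(q+r)\equiv p\cdot q+p\cdot r$; $(p+q)\cdot r\equiv p\cdot r+q\cdot r$; $0\cdot p\equiv 0$; $p\cdot 0\equiv 0$; $1+p\cdot p^*\equiv p^*$; $1+p^*\cdot p\equiv p^*$; $q+p\cdot r\le r\Rightarrow p^*\cdot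 q\le r$; $p+q\cdot r\le q\Rightarrow p\cdot r^*\le q$; - for all predicates $a,b,c$: $a+(b\cdot c)\equiv(a+b)\cdot(a+c)$; $a+1\equiv 1$; $a+\neg a\equiv 1$; $a\cdot b\equiv b\cdot a$; $a\cdot\neg a\equiv 0$; $a\cdot a\equiv a$; - for all fields $f,f'$ and values: $f\leftarrow n\cdot f'\leftarrow n'\equiv f'\leftarrow n'\cdot f\leftarrow n$ if $f\ne f'$; $f\leftarrow n\cdot f'=n'\equiv f'=n'\cdot f\leftarrow n$ if $f\neq f'$; $\mathbf{dup}\cdot f=n\equiv f=n\cdot\mathbf{dup}$; $f\leftarrow n\cdot f=n\equiv f\leftarrow n$; $f=n\cdot f\leftarrow n\equiv f=n$ (PA-FILTER-MOD); $f\leftarrow n\cdot f\leftarrow n'\equiv f\leftarrow n'$ (PA-MOD-MOD); $f=n\cdot f=n'\equiv 0$ if $n\ne n'$; $\sum_i f=i\equiv 1$, the sum being over all values $i$ of $f$. Let $\vdash_s$ be derivability in the same system with the axioms PA-MOD-MOD and PA-FILTER-MOD removed. Let $t$, $p$, $\mathit{in}$, $\mathit{out}$ be NetKAT policies in which neither $\mathbf{dup}$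 nor the Kleene star occurs. Then $$\vdash \mathit{in}\cdot(p\cdot t)^*\cdot\mathit{out}\equiv 0 \quad\text{if and only if}\quad \forall n\in\mathbb{N}.\ \vdash_s \mathit{in}\cdot(1+p\cdot t)^n\cdot\mathit{out}\equiv 0 .$$ -/

import Mathlib

namespace NetKAT

/-! There are finitely many packet fields, indexed by `Fin k`, and the field `f` takes its
values in the finite set `Fin (m f)`. -/

/-- NetKAT predicates. -/
inductive Pred {k : ℕ} (m : Fin k → ℕ) : Type where
  | one : Pred m
  | zero : Pred m
  | test (f : Fin k) (n : Fin (m f)) : Pred m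
  | or (a b : Pred m) : Pred m
  | and (a b : Pred m) : Pred m
  | neg (a : Pred m) : Pred m

/-- NetKAT policies. In the grammar of NetKAT every predicate is a policy, and `1`, `0`, `+` and
`·` on predicates are the same symbols as on policies. So a policy is built from `1`, `0`, tests,
negated predicates, modifications and `dup` with `+`, `·` and `*`; the inclusion of predicates
into policies is the function `Pred.toPolicy` below. -/
inductive Policy {k : ℕ} (m : Fin k → ℕ) : Type where
  | one : Policy m
  | zero : Policy m
  | test (f : Fin k) (n : Fin (m f)) : Policy m
  | neg (a : Pred m) : Policy m
  | mod (f : Fin k) (n : Fin (m f)) : Policy m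
  | union (p q : Policy m) : Policy m
  | seq (p q : Policy m) : Policy m
  | star (p : Policy m) : Policy m
  | dup : Policy m

section Operations

variable {k : ℕ} {m : Fin k → ℕ}

instance : One (Pred m) := ⟨Pred.one⟩
instance : Zero (Pred m) := ⟨Pred.zero⟩
instance : Add (Pred m) := ⟨Pred.or⟩
instance : Mul (Pred m) := ⟨Pred.and⟩

instance : One (Policy m) := ⟨Policy.one⟩
instance : Zero (Policy m) := ⟨Policy.zero⟩
instance : Add (Policy m) := ⟨Policy.union⟩
instance : Mul (Policy m) := ⟨Policy.seq⟩

/-- A predicate, read as a policy. -/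
def Pred.toPolicy : Pred m → Policy m
  | .one => .one
  | .zero => .zero
  | .test f n => .test f n
  | .or a b => .union a.toPolicy b.toPolicy
  | .and a b => .seq a.toPolicy b.toPolicy
  | .neg a => .neg a

instance : Coe (Pred m) (Policy m) := ⟨Pred.toPolicy⟩

/-- Repetition: `q ^ 0 = 1` and `q ^ (n + 1) = q · q ^ n`. -/
def Policy.pow (q : Policy m) : ℕ → Policy m
  | 0 => 1
  | n + 1 => q * Policy.pow q n

instance : Pow (Policy m) ℕ := ⟨Policy.pow⟩

/-- The sum `∑ᵢ (f = i)` over all values `i` of the field `f`. -/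
def Policy.sumTests (f : Fin k) : Policy m :=
  (List.finRange (m f)).foldr (fun i s => Policy.test f i + s) 0

/-- `dup` does not occur in the policy. -/
def Policy.DupFree : Policy m → Prop
  | .union p q => p.DupFree ∧ q.DupFree
  | .seq p q => p.DupFree ∧ q.DupFree
  | .star p => p.DupFree
  | .dup => False
  | _ => True

/-- The Kleene star does not occur in the policy. -/
def Policy.StarFree : Policy m → Prop
  | .union p q => p.StarFree ∧ q.StarFree
  | .seq p q => p.StarFree ∧ q.StarFree
  | .star _ => False
  | _ => True

end Operations

/-- The two axiomatisations: the one of NetKAT, and the modified one, which has all the axioms of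
NetKAT except PA-MOD-MOD and PA-FILTER-MOD. -/
inductive EqSystem : Type where
  | full
  | safety

/-- `Provable S p q`: the equation `p ≡ q` between NetKAT policies is derivable in the
axiomatisation `S`, that is, by the rules of equational logic from the axioms of `S`. An
inequality `p ≤ q` stands for the equation `p + q ≡ q`. -/
inductive Provable {k : ℕ} {m : Fin k → ℕ} (S : EqSystem) : Policy m → Policy m → Prop where
  -- equational logic
  | refl (p : Policy m) : Provable S p p
  | symm {p q : Policy m} : Provable S p q → Provable S q p
  | trans {p q r : Policy m} : Provable S p q → Provable S q r → Provable S p r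
  | congr_plus {p p' q q' : Policy m} :
      Provable S p p' → Provable S q q' → Provable S (p + q) (p' + q')
  | congr_seq {p p' q q' : Policy m} :
      Provable S p p' → Provable S q q' → Provable S (p * q) (p' * q')
  | congr_star {p p' : Policy m} : Provable S p p' → Provable S p.star p'.star
  | congr_neg {a b : Pred m} :
      Provable S (a : Policy m) (b : Policy m) → Provable S (Policy.neg a) (Policy.neg b)
  -- Kleene algebra axioms
  | ka_plus_assoc (p q r : Policy m) : Provable S (p + (q + r)) ((p + q) + r)
  | ka_plus_comm (p q : Policy m) : Provable S (p + q) (q + p)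
  | ka_plus_zero (p : Policy m) : Provable S (p + 0) p
  | ka_plus_idem (p : Policy m) : Provable S (p + p) p
  | ka_seq_assoc (p q r : Policy m) : Provable S (p * (q * r)) ((p * q) * r)
  | ka_one_seq (p : Policy m) : Provable S (1 * p) p
  | ka_seq_one (p : Policy m) : Provable S (p * 1) p
  | ka_seq_dist_l (p q r : Policy m) : Provable S (p * (q + r)) (p * q + p * r)
  | ka_seq_dist_r (p q r : Policy m) : Provable S ((p + q) * r) (p * r + q * r)
  | ka_zero_seq (p : Policy m) : Provable S (0 * p) 0
  | ka_seq_zero (p : Policy m) : Provable S (p * 0) 0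
  | ka_unroll_l (p : Policy m) : Provable S (1 + p * p.star) p.star
  | ka_unroll_r (p : Policy m) : Provable S (1 + p.star * p) p.star
  | ka_lfp_l {p q r : Policy m} :
      Provable S ((q + p * r) + r) r → Provable S (p.star * q + r) r
  | ka_lfp_r {p q r : Policy m} :
      Provable S ((p + q * r) + q) q → Provable S (p * r.star + q) q
  -- Boolean algebra axioms, for predicates
  | ba_plus_dist (a b c : Pred m) :
      Provable S ((a : Policy m) + (b : Policy m) * (c : Policy m))
        (((a : Policy m) + (b : Policy m)) * ((a : Policy m) + (c : Policy m)))
  | ba_plus_one (a : Pred m) : Provable S ((a : Policy m) + 1) 1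
  | ba_excl_mid (a : Pred m) : Provable S ((a : Policy m) + Policy.neg a) 1
  | ba_seq_comm (a b : Pred m) :
      Provable S ((a : Policy m) * (b : Policy m)) ((b : Policy m) * (a : Policy m))
  | ba_contra (a : Pred m) : Provable S ((a : Policy m) * Policy.neg a) 0
  | ba_seq_idem (a : Pred m) : Provable S ((a : Policy m) * (a : Policy m)) (a : Policy m)
  -- packet algebra axioms
  | pa_mod_mod_comm (f f' : Fin k) (n : Fin (m f)) (n' : Fin (m f')) : f ≠ f' →
      Provable S (Policy.mod f n * Policy.mod f' n') (Policy.mod f' n' * Policy.mod f n)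
  | pa_mod_filter_comm (f f' : Fin k) (n : Fin (m f)) (n' : Fin (m f')) : f ≠ f' →
      Provable S (Policy.mod f n * Policy.test f' n') (Policy.test f' n' * Policy.mod f n)
  | pa_dup_filter_comm (f : Fin k) (n : Fin (m f)) :
      Provable S (Policy.dup * Policy.test f n) (Policy.test f n * Policy.dup)
  | pa_mod_filter (f : Fin k) (n : Fin (m f)) :
      Provable S (Policy.mod f n * Policy.test f n) (Policy.mod f n)
  | pa_contra (f : Fin k) (n n' : Fin (m f)) : n ≠ n' →
      Provable S (Policy.test f n * Policy.test f n') 0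
  | pa_match_all (f : Fin k) : Provable S (Policy.sumTests f) 1
  -- the two axioms that only the axiomatisation of NetKAT has
  | pa_filter_mod (f : Fin k) (n : Fin (m f)) : S = EqSystem.full →
      Provable S (Policy.test f n * Policy.mod f n) (Policy.test f n)
  | pa_mod_mod (f : Fin k) (n n' : Fin (m f)) : S = EqSystem.full →
      Provable S (Policy.mod f n * Policy.mod f n') (Policy.mod f n')

end NetKAT

/-! Both sides say the same about input-output relations: no packet can pass through `ingress`,
finitely many rounds of `p * t`, and `egress`. Derivable equations hold for these relations
(`Provable.rel_iff`), and the star relates two packets exactly when some power of `1 + p * t` does.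

The converse is completeness for equations `e ≡ 0`. The complete tests of packets (`atom`) sum to
`1` and cut a policy into blocks `atom x * e * atom y`. If `e` has no `dup` and no star, a block
whose packets are unrelated is provably `0` (`atom_mul_mul_atom`). This only tracks where packets
cannot go, so PA-MOD-MOD and PA-FILTER-MOD are never used. For the star, the packets from which no
output is reachable form an inductive invariant, and the least-fixed-point rule turns it into a
derivation (`Provable.mul_star_mul_zero`). -/

namespace NetKAT

/-! ### Relational semantics and soundness -/

section Semantics

variable {k : ℕ} {m : Fin k → ℕ}

/-- A packet assigns a value to each field. -/
abbrev Packet (m : Fin k → ℕ) : Type := (f : Fin k) → Fin (m f)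

/-- The packets that satisfy a predicate. -/
def Pred.Holds : Pred m → Packet m → Prop
  | .one, _ => True
  | .zero, _ => False
  | .test f n, x => x f = n
  | .or a b, x => a.Holds x ∨ b.Holds x
  | .and a b, x => a.Holds x ∧ b.Holds x
  | .neg a, x => ¬ a.Holds x

/-- The input-output relation of a policy on packets; histories are not recorded, so that `dup`
is the identity. -/
def Policy.Rel : Policy m → Packet m → Packet m → Prop
  | .one, x, y => x = y
  | .zero, _, _ => False
  | .test f n, x, y => x = y ∧ x f = n
  | .neg a, x, y => x = y ∧ ¬ a.Holds x
  | .mod f n, x, y => y = Function.update x f n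
  | .union p q, x, y => p.Rel x y ∨ q.Rel x y
  | .seq p q, x, y => ∃ z, p.Rel x z ∧ q.Rel z y
  | .star p, x, y => Relation.ReflTransGen p.Rel x y
  | .dup, x, y => x = y

@[simp] theorem Policy.rel_one (x y : Packet m) : (1 : Policy m).Rel x y ↔ x = y := Iff.rfl

@[simp] theorem Policy.rel_zero (x y : Packet m) : (0 : Policy m).Rel x y ↔ False := Iff.rfl

@[simp] theorem Policy.rel_add (p q : Policy m) (x y : Packet m) :
    (p + q).Rel x y ↔ p.Rel x y ∨ q.Rel x y := Iff.rfl

@[simp] theorem Policy.rel_mul (p q : Policy m) (x y : Packet m) :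
    (p * q).Rel x y ↔ ∃ z, p.Rel x z ∧ q.Rel z y := Iff.rfl

@[simp] theorem Policy.rel_star (p : Policy m) (x y : Packet m) :
    p.star.Rel x y ↔ Relation.ReflTransGen p.Rel x y := Iff.rfl

@[simp] theorem Policy.rel_test (f : Fin k) (n : Fin (m f)) (x y : Packet m) :
    (Policy.test f n).Rel x y ↔ x = y ∧ x f = n := Iff.rfl

@[simp] theorem Policy.rel_neg (a : Pred m) (x y : Packet m) :
    (Policy.neg a).Rel x y ↔ x = y ∧ ¬ a.Holds x := Iff.rfl

@[simp] theorem Policy.rel_mod (f : Fin k) (n : Fin (m f)) (x y : Packet m) :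
    (Policy.mod f n).Rel x y ↔ y = Function.update x f n := Iff.rfl

@[simp] theorem Policy.rel_dup (x y : Packet m) : (Policy.dup : Policy m).Rel x y ↔ x = y := Iff.rfl

@[simp] theorem Pred.rel_toPolicy (a : Pred m) (x y : Packet m) :
    a.toPolicy.Rel x y ↔ x = y ∧ a.Holds x := by
  induction a generalizing x y with
  | one => simp [Pred.toPolicy, Policy.Rel, Pred.Holds]
  | zero => simp [Pred.toPolicy, Policy.Rel, Pred.Holds]
  | test f n => simp [Pred.toPolicy, Pred.Holds]
  | neg a => simp [Pred.toPolicy, Pred.Holds]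
  | or a b iha ihb => simp only [Pred.toPolicy, Policy.Rel, Pred.Holds, iha, ihb]; tauto
  | and a b iha ihb =>
    simp only [Pred.toPolicy, Policy.Rel, Pred.Holds, iha, ihb]
    constructor
    · rintro ⟨z, ⟨rfl, h⟩, rfl, h'⟩
      exact ⟨rfl, h, h'⟩
    · rintro ⟨rfl, h, h'⟩
      exact ⟨x, ⟨rfl, h⟩, rfl, h'⟩

theorem Policy.rel_sumTests (f : Fin k) (x y : Packet m) :
    (Policy.sumTests f : Policy m).Rel x y ↔ x = y := by
  have key : ∀ l : List (Fin (m f)),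
      (l.foldr (fun i s => Policy.test f i + s) (0 : Policy m)).Rel x y ↔ x = y ∧ x f ∈ l := by
    intro l
    induction l with
    | nil => simp
    | cons i l ih => simp only [List.foldr_cons, Policy.rel_add, Policy.rel_test, ih,
        List.mem_cons]; tauto
  simp [Policy.sumTests, key]

/-- Derivable equations hold between the input-output relations. -/
theorem Provable.rel_iff {S : EqSystem} {p q : Policy m} (h : Provable S p q) :
    ∀ x y, p.Rel x y ↔ q.Rel x y := by
  induction h with
  | refl => intros; rfl
  | symm _ ih => exact fun x y => (ih x y).symm
  | trans _ _ ih ih' => exact fun x y => (ih x y).trans (ih' x y)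
  | congr_plus _ _ ih ih' => intro x y; simp [ih, ih']
  | congr_seq _ _ ih ih' => intro x y; simp [ih, ih']
  | @congr_star p p' _ ih =>
    intro x y
    have : p.Rel = p'.Rel := by ext; apply ih
    simp [this]
  | @congr_neg a b _ ih =>
    intro x y
    -- A predicate relates packets only to themselves, so the diagonal already determines where it
    -- holds.
    have := ih x x
    simp only [Pred.rel_toPolicy, true_and] at this
    simp [this]
  | ka_plus_assoc => intro x y; simp [or_assoc]
  | ka_plus_comm => intro x y; simp [or_comm]
  | ka_plus_zero => intro x y; simp
  | ka_plus_idem => intro x y; simp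
  | ka_seq_assoc =>
    intro x y; simp only [Policy.rel_mul]
    constructor
    · rintro ⟨z, h, w, h', h''⟩; exact ⟨w, ⟨z, h, h'⟩, h''⟩
    · rintro ⟨z, ⟨w, h, h'⟩, h''⟩; exact ⟨w, h, z, h', h''⟩
  | ka_one_seq => intro x y; simp
  | ka_seq_one => intro x y; simp
  | ka_seq_dist_l => intro x y; simp [and_or_left, exists_or]
  | ka_seq_dist_r => intro x y; simp [or_and_right, exists_or]
  | ka_zero_seq => intro x y; simp
  | ka_seq_zero => intro x y; simp
  | ka_unroll_l p =>
    intro x y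
    simp only [Policy.rel_add, Policy.rel_one, Policy.rel_mul, Policy.rel_star]
    rw [Relation.ReflTransGen.cases_head_iff]
  | ka_unroll_r p =>
    intro x y
    simp only [Policy.rel_add, Policy.rel_one, Policy.rel_mul, Policy.rel_star]
    rw [Relation.ReflTransGen.cases_tail_iff p.Rel x y, eq_comm]
  | @ka_lfp_l p q r _ ih =>
    intro x y
    simp only [Policy.rel_add, Policy.rel_mul, Policy.rel_star, or_iff_right_iff_imp] at ih ⊢
    rintro ⟨z, hxz, hzy⟩
    induction hxz using Relation.ReflTransGen.head_induction_on with
    | refl => exact ih _ _ (Or.inl hzy)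
    | head h _ ih' => exact ih _ _ (Or.inr ⟨_, h, ih'⟩)
  | @ka_lfp_r p q r _ ih =>
    intro x y
    simp only [Policy.rel_add, Policy.rel_mul, Policy.rel_star, or_iff_right_iff_imp] at ih ⊢
    rintro ⟨z, hxz, hzy⟩
    induction hzy with
    | refl => exact ih _ _ (Or.inl hxz)
    | tail _ h ih' => exact ih _ _ (Or.inr ⟨_, ih', h⟩)
  | ba_plus_dist a b c =>
    intro x y
    have h (u v : Pred m) : (u : Policy m) + (v : Policy m) = (Pred.or u v).toPolicy := rfl
    have h' (u v : Pred m) : (u : Policy m) * (v : Policy m) = (Pred.and u v).toPolicy := rfl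
    rw [h, h, h', h, h', Pred.rel_toPolicy, Pred.rel_toPolicy]
    simp only [Pred.Holds]; tauto
  | ba_plus_one => intro x y; simp only [Policy.rel_add, Pred.rel_toPolicy, Policy.rel_one]; tauto
  | ba_excl_mid =>
    intro x y
    simp only [Policy.rel_add, Pred.rel_toPolicy, Policy.rel_one, Policy.rel_neg]; tauto
  | ba_seq_comm a b =>
    intro x y
    have h' (u v : Pred m) : (u : Policy m) * (v : Policy m) = (Pred.and u v).toPolicy := rfl
    rw [h', h', Pred.rel_toPolicy, Pred.rel_toPolicy]
    simp only [Pred.Holds]; tauto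
  | ba_contra a =>
    intro x y
    simp only [Policy.rel_mul, Pred.rel_toPolicy, Policy.rel_zero, Policy.rel_neg, iff_false]
    rintro ⟨z, ⟨rfl, h⟩, _, h'⟩
    exact h' h
  | ba_seq_idem a =>
    intro x y
    have h' (u v : Pred m) : (u : Policy m) * (v : Policy m) = (Pred.and u v).toPolicy := rfl
    rw [h', Pred.rel_toPolicy, Pred.rel_toPolicy]
    simp only [Pred.Holds]; tauto
  | pa_mod_mod_comm f f' n n' hf =>
    intro x y
    simp [Function.update_comm hf]
  | pa_mod_filter_comm f f' n n' hf =>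
    intro x y
    simp only [Policy.rel_mul, Policy.rel_mod, Policy.rel_test]
    constructor
    · rintro ⟨z, rfl, rfl, h⟩
      rw [Function.update_of_ne hf.symm] at h
      exact ⟨x, ⟨rfl, h⟩, rfl⟩
    · rintro ⟨z, ⟨rfl, h⟩, rfl⟩
      exact ⟨_, rfl, rfl, by rwa [Function.update_of_ne hf.symm]⟩
  -- Derivations between `dup`-free policies may pass through `dup`, so this axiom has to be
  -- validated as well.
  | pa_dup_filter_comm f n => intro x y; simp
  | pa_mod_filter f n =>
    intro x y
    simp only [Policy.rel_mul, Policy.rel_mod, Policy.rel_test]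
    constructor
    · rintro ⟨z, rfl, rfl, h⟩; rfl
    · rintro rfl; exact ⟨_, rfl, rfl, by simp⟩
  | pa_contra f n n' hn =>
    intro x y
    simp only [Policy.rel_mul, Policy.rel_zero, Policy.rel_test, iff_false]
    rintro ⟨z, ⟨rfl, h⟩, _, h'⟩
    exact hn (h.symm.trans h')
  | pa_match_all f => exact Policy.rel_sumTests f
  | pa_filter_mod f n =>
    intro x y
    simp only [Policy.rel_mul, Policy.rel_mod, Policy.rel_test]
    constructor
    · rintro ⟨z, ⟨rfl, rfl⟩, rfl⟩; simp
    · rintro ⟨rfl, rfl⟩; exact ⟨x, ⟨rfl, rfl⟩, by simp⟩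
  | pa_mod_mod f n n' => intro x y; simp

end Semantics

/-! ### The idempotent semiring of policies modulo provable equality -/

section Quotient

variable {k : ℕ} {m : Fin k → ℕ}

/-- Provable equality as a setoid. -/
def provableSetoid (S : EqSystem) (m : Fin k → ℕ) : Setoid (Policy m) where
  r := Provable S
  iseqv := ⟨.refl, .symm, .trans⟩

/-- Policies up to provable equality. -/
def PolicyClass (S : EqSystem) (m : Fin k → ℕ) : Type := Quotient (provableSetoid S m)

/-- The class of a policy up to provable equality. -/
def Policy.toClass (S : EqSystem) (p : Policy m) : PolicyClass S m :=
  Quotient.mk (provableSetoid S m) p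

variable {S : EqSystem}

theorem Policy.toClass_eq_iff {p q : Policy m} : p.toClass S = q.toClass S ↔ Provable S p q :=
  Quotient.eq (r := provableSetoid S m)

instance : Zero (PolicyClass S m) := ⟨(0 : Policy m).toClass S⟩
instance : One (PolicyClass S m) := ⟨(1 : Policy m).toClass S⟩
instance : Add (PolicyClass S m) :=
  ⟨Quotient.map₂ (· + ·) fun _ _ h _ _ h' => Provable.congr_plus h h'⟩
instance : Mul (PolicyClass S m) :=
  ⟨Quotient.map₂ (· * ·) fun _ _ h _ _ h' => Provable.congr_seq h h'⟩

theorem Policy.toClass_one : (1 : Policy m).toClass S = 1 := rfl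
theorem Policy.toClass_add (p q : Policy m) : (p + q).toClass S = p.toClass S + q.toClass S := rfl

theorem PolicyClass.ind {P : PolicyClass S m → Prop} (h : ∀ p : Policy m, P (p.toClass S))
    (x : PolicyClass S m) : P x := Quotient.ind h x

instance : Semiring (PolicyClass S m) where
  add_assoc := by
    refine PolicyClass.ind fun p => PolicyClass.ind fun q => PolicyClass.ind fun r => ?_
    exact Policy.toClass_eq_iff.2 (.symm (.ka_plus_assoc p q r))
  zero_add := by
    refine PolicyClass.ind fun p => ?_
    exact Policy.toClass_eq_iff.2 (.trans (.ka_plus_comm _ _) (.ka_plus_zero p))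
  add_zero := by
    refine PolicyClass.ind fun p => ?_
    exact Policy.toClass_eq_iff.2 (.ka_plus_zero p)
  add_comm := by
    refine PolicyClass.ind fun p => PolicyClass.ind fun q => ?_
    exact Policy.toClass_eq_iff.2 (.ka_plus_comm p q)
  mul_assoc := by
    refine PolicyClass.ind fun p => PolicyClass.ind fun q => PolicyClass.ind fun r => ?_
    exact Policy.toClass_eq_iff.2 (.symm (.ka_seq_assoc p q r))
  one_mul := by
    refine PolicyClass.ind fun p => ?_
    exact Policy.toClass_eq_iff.2 (.ka_one_seq p)
  mul_one := by
    refine PolicyClass.ind fun p => ?_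
    exact Policy.toClass_eq_iff.2 (.ka_seq_one p)
  left_distrib := by
    refine PolicyClass.ind fun p => PolicyClass.ind fun q => PolicyClass.ind fun r => ?_
    exact Policy.toClass_eq_iff.2 (.ka_seq_dist_l p q r)
  right_distrib := by
    refine PolicyClass.ind fun p => PolicyClass.ind fun q => PolicyClass.ind fun r => ?_
    exact Policy.toClass_eq_iff.2 (.ka_seq_dist_r p q r)
  zero_mul := by
    refine PolicyClass.ind fun p => ?_
    exact Policy.toClass_eq_iff.2 (.ka_zero_seq p)
  mul_zero := by
    refine PolicyClass.ind fun p => ?_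
    exact Policy.toClass_eq_iff.2 (.ka_seq_zero p)
  nsmul := nsmulRec

theorem PolicyClass.add_self (x : PolicyClass S m) : x + x = x := by
  induction x using PolicyClass.ind with
  | h p => exact Policy.toClass_eq_iff.2 (.ka_plus_idem p)

/-! ### Complete tests of packets -/

/-- The class of a test. -/
def testClass (S : EqSystem) (f : Fin k) (n : Fin (m f)) : PolicyClass S m :=
  (Policy.test f n).toClass S

theorem testClass_comm (f f' : Fin k) (n : Fin (m f)) (n' : Fin (m f')) :
    testClass S f n * testClass S f' n' = testClass S f' n' * testClass S f n :=
  Policy.toClass_eq_iff.2 (.ba_seq_comm (.test f n) (.test f' n'))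

theorem testClass_mul_self (f : Fin k) (n : Fin (m f)) :
    testClass S f n * testClass S f n = testClass S f n :=
  Policy.toClass_eq_iff.2 (.ba_seq_idem (.test f n))

theorem testClass_mul_of_ne {f : Fin k} {n n' : Fin (m f)} (h : n ≠ n') :
    testClass S f n * testClass S f n' = 0 :=
  Policy.toClass_eq_iff.2 (.pa_contra f n n' h)

theorem sum_testClass (f : Fin k) : ∑ n : Fin (m f), testClass S f n = 1 := by
  have key : ∀ l : List (Fin (m f)),
      (l.foldr (fun i s => Policy.test f i + s) (0 : Policy m)).toClass S =
        (l.map (testClass S f)).sum := by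
    intro l
    induction l with
    | nil => rfl
    | cons i l ih => simp [Policy.toClass_add, ih, testClass]
  have h := Policy.toClass_eq_iff.2 (Provable.pa_match_all (S := S) (m := m) f)
  rw [Policy.sumTests, key, Policy.toClass_one] at h
  rw [← h, ← List.sum_ofFn, List.ofFn_eq_map]

/-- The subsemiring generated by the tests. -/
def testSubsemiring (S : EqSystem) (m : Fin k → ℕ) : Subsemiring (PolicyClass S m) :=
  Subsemiring.closure {x | ∃ f n, testClass S f n = x}

/-- Tests commute with each other, though policies do not; this makes unordered products over the
fields available. -/
instance : CommSemiring (testSubsemiring S m) where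
  mul_comm := (Subsemiring.isMulCommutative_closure (by
    rintro _ ⟨f, n, rfl⟩ _ ⟨f', n', rfl⟩
    exact testClass_comm f f' n n')).is_comm.comm

/-- A test as an element of the subsemiring generated by the tests. -/
def testElem (S : EqSystem) (f : Fin k) (n : Fin (m f)) : testSubsemiring S m :=
  ⟨testClass S f n, Subsemiring.subset_closure ⟨f, n, rfl⟩⟩

/-- The complete test for a packet: the product of the tests for its field values. -/
def atom (S : EqSystem) (x : Packet m) : PolicyClass S m :=
  ((∏ f, testElem S f (x f) : testSubsemiring S m) : PolicyClass S m)

/-- For each field the tests sum to `1`; multiplying these sums over all fields and expanding yields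
one term per packet. -/
theorem sum_atom : ∑ x : Packet m, atom S x = 1 := by
  have h : ∀ f : Fin k, ∑ n : Fin (m f), testElem S f n = 1 := by
    intro f
    apply Subtype.ext
    rw [AddSubmonoidClass.coe_finsetSum]
    exact sum_testClass f
  have h2 : ∑ x : Packet m, ∏ f, testElem S f (x f) = 1 := by
    rw [← Fintype.prod_sum]
    exact Finset.prod_eq_one fun f _ => h f
  have h3 := congrArg (Subtype.val) h2
  rw [AddSubmonoidClass.coe_finsetSum] at h3
  exact h3

theorem testClass_mul_atom (f : Fin k) (x : Packet m) :
    testClass S f (x f) * atom S x = atom S x := by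
  have h : testElem S f (x f) * ∏ f, testElem S f (x f) = ∏ f, testElem S f (x f) := by
    rw [← Finset.mul_prod_erase _ _ (Finset.mem_univ f), ← mul_assoc]
    congr 1
    exact Subtype.ext (testClass_mul_self f (x f))
  exact congrArg Subtype.val h

theorem testClass_comm_atom (f : Fin k) (n : Fin (m f)) (x : Packet m) :
    testClass S f n * atom S x = atom S x * testClass S f n :=
  congrArg Subtype.val (mul_comm (testElem S f n) (∏ f, testElem S f (x f)))

theorem atom_mul_testClass (f : Fin k) (x : Packet m) :
    atom S x * testClass S f (x f) = atom S x := by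
  rw [← testClass_comm_atom, testClass_mul_atom]

theorem atom_mul_testClass_of_ne {f : Fin k} {n : Fin (m f)} {x : Packet m} (h : x f ≠ n) :
    atom S x * testClass S f n = 0 := by
  rw [← atom_mul_testClass f, mul_assoc, testClass_mul_of_ne h, mul_zero]

theorem atom_mul_atom_of_ne {x y : Packet m} (h : x ≠ y) : atom S x * atom S y = 0 := by
  obtain ⟨f, hf⟩ := Function.ne_iff.1 h
  rw [← testClass_mul_atom f y, ← mul_assoc, atom_mul_testClass_of_ne hf, zero_mul]

theorem eq_zero_of_atom_mul {e : PolicyClass S m} (h : ∀ x y, atom S x * e * atom S y = 0) :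
    e = 0 := by
  have : e = (∑ x, atom S x) * e * ∑ y, atom S y := by simp [sum_atom]
  rw [this, Finset.sum_mul, Finset.sum_mul]
  refine Finset.sum_eq_zero fun x _ => ?_
  rw [Finset.mul_sum]
  exact Finset.sum_eq_zero fun y _ => h x y

-- A complete test decides every predicate. For a negation, the contradiction axiom settles the case
-- where `a` holds and excluded middle the other.
open Classical in
theorem atom_mul_pred (a : Pred m) (x : Packet m) :
    atom S x * a.toPolicy.toClass S = if a.Holds x then atom S x else 0 := by
  induction a with
  | one => exact (mul_one (atom S x)).trans (if_pos trivial).symm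
  | zero => exact (mul_zero (atom S x)).trans (if_neg id).symm
  | test f n =>
    change atom S x * testClass S f n = _
    split_ifs with h
    · obtain rfl : x f = n := h
      exact atom_mul_testClass f x
    · exact atom_mul_testClass_of_ne h
  | or a b iha ihb =>
    change atom S x * (a.toPolicy.toClass S + b.toPolicy.toClass S) = _
    rw [mul_add, iha, ihb]
    by_cases ha : a.Holds x <;> by_cases hb : b.Holds x <;>
      simp [Pred.Holds, ha, hb, PolicyClass.add_self]
  | and a b iha ihb =>
    change atom S x * (a.toPolicy.toClass S * b.toPolicy.toClass S) = _
    rw [← mul_assoc, iha]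
    by_cases ha : a.Holds x <;> simp [Pred.Holds, ha, ihb]
  | neg a iha =>
    change atom S x * (Policy.neg a).toClass S = _
    by_cases ha : a.Holds x
    · have h : a.toPolicy.toClass S * (Policy.neg a).toClass S = 0 :=
        Policy.toClass_eq_iff.2 (.ba_contra a)
      rw [if_pos ha] at iha
      rw [if_neg (show ¬ (Pred.neg a).Holds x from not_not.2 ha), ← iha, mul_assoc, h, mul_zero]
    · have h : a.toPolicy.toClass S + (Policy.neg a).toClass S = 1 :=
        Policy.toClass_eq_iff.2 (.ba_excl_mid a)
      rw [if_neg ha] at iha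
      have h' := congrArg (atom S x * ·) h
      simp only [mul_add, iha, zero_add, mul_one] at h'
      rw [if_pos (show (Pred.neg a).Holds x from ha), h']

theorem atom_mul_pred_mul_atom {a : Pred m} {x y : Packet m} (h : ¬ (x = y ∧ a.Holds x)) :
    atom S x * a.toPolicy.toClass S * atom S y = 0 := by
  rw [atom_mul_pred]
  split_ifs with ha
  · exact atom_mul_atom_of_ne fun hxy => h ⟨hxy, ha⟩
  · exact zero_mul _

/-- If `y` is wrong at `f`, the test `f = n` that the modification absorbs on its right contradicts
`atom y`. If `y` is wrong at another field, its test there commutes left past the modification and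
contradicts `atom x`. -/
theorem atom_mul_mod_mul_atom {f : Fin k} {n : Fin (m f)} {x y : Packet m}
    (h : y ≠ Function.update x f n) :
    atom S x * (Policy.mod f n).toClass S * atom S y = 0 := by
  by_cases hn : y f = n
  · obtain ⟨f', hf'⟩ := Function.ne_iff.1 h
    have hne : f ≠ f' := by
      rintro rfl
      simp [hn] at hf'
    rw [Function.update_of_ne hne.symm] at hf'
    have hc : (Policy.mod f n).toClass S * testClass S f' (y f') =
        testClass S f' (y f') * (Policy.mod f n).toClass S :=
      Policy.toClass_eq_iff.2 (.pa_mod_filter_comm f f' n (y f') hne)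
    rw [← testClass_mul_atom f' y, mul_assoc, ← mul_assoc (Policy.toClass S _), hc, ← mul_assoc,
      ← mul_assoc, atom_mul_testClass_of_ne hf'.symm, zero_mul, zero_mul]
  · have hc : (Policy.mod f n).toClass S * testClass S f n = (Policy.mod f n).toClass S :=
      Policy.toClass_eq_iff.2 (.pa_mod_filter f n)
    rw [← hc, mul_assoc, mul_assoc, testClass_comm_atom, atom_mul_testClass_of_ne hn, mul_zero,
      mul_zero]

/-! ### Provable emptiness without the star -/

/-- Between packets that a policy without `dup` and star does not relate, the policy is provably
zero, in either axiomatisation. -/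
theorem atom_mul_mul_atom {e : Policy m} (hd : e.DupFree) (hs : e.StarFree) {x y : Packet m}
    (h : ¬ e.Rel x y) : atom S x * e.toClass S * atom S y = 0 := by
  induction e generalizing x y with
  | one => exact atom_mul_pred_mul_atom (a := .one) fun h' => h h'.1
  | zero => exact atom_mul_pred_mul_atom (a := .zero) fun h' => h'.2
  | test f n => exact atom_mul_pred_mul_atom (a := .test f n) h
  | neg a => exact atom_mul_pred_mul_atom (a := .neg a) h
  | mod f n => exact atom_mul_mod_mul_atom h
  | union p q ihp ihq =>
    change atom S x * (p.toClass S + q.toClass S) * atom S y = 0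
    rw [mul_add, add_mul, ihp hd.1 hs.1 fun h' => h (Or.inl h'),
      ihq hd.2 hs.2 fun h' => h (Or.inr h'), add_zero]
  | seq p q ihp ihq =>
    change atom S x * (p.toClass S * q.toClass S) * atom S y = 0
    -- Insert `1` as the sum of all complete tests between `p` and `q`: for each intermediate packet
    -- `z`, one of the two factors vanishes.
    rw [← mul_one (p.toClass S), ← sum_atom, Finset.mul_sum, Finset.sum_mul, Finset.mul_sum,
      Finset.sum_mul]
    refine Finset.sum_eq_zero fun z _ => ?_
    by_cases hz : p.Rel x z
    · have := ihq hd.2 hs.2 fun h' => h ⟨z, hz, h'⟩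
      rw [mul_assoc, mul_assoc, mul_assoc, ← mul_assoc (atom S z), this, mul_zero, mul_zero]
    · have := ihp hd.1 hs.1 hz
      rw [← mul_assoc, ← mul_assoc, this, zero_mul, zero_mul]
  | star p => exact hs.elim
  | dup => exact hd.elim

/-- A policy without `dup` and star that drops all packets is provably zero, in either
axiomatisation. -/
theorem Provable.zero_of_rel_empty {e : Policy m} (hd : e.DupFree) (hs : e.StarFree)
    (h : ∀ x y, ¬ e.Rel x y) : Provable S e 0 :=
  Policy.toClass_eq_iff.1 (eq_zero_of_atom_mul fun x y => atom_mul_mul_atom hd hs (h x y))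

/-! ### Sets of packets and the invariant of an iteration -/

open Classical in
/-- The sum of the complete tests for the packets in a set. -/
noncomputable def setTest (S : EqSystem) (B : Set (Packet m)) : PolicyClass S m :=
  ∑ x with x ∈ B, atom S x

theorem setTest_add_setTest_compl (B : Set (Packet m)) : setTest S B + setTest S Bᶜ = 1 := by
  classical
  rw [← sum_atom, ← Finset.sum_filter_add_sum_filter_not Finset.univ (· ∈ B)]
  unfold setTest
  congr!

theorem setTest_univ : setTest S (Set.univ : Set (Packet m)) = 1 := by
  simp [setTest, sum_atom]

/-- A policy without `dup` and star that relates no packet of `B` to one of `C` is provably zero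
between the tests for `B` and `C`. -/
theorem setTest_mul_mul_setTest {e : Policy m} (hd : e.DupFree) (hs : e.StarFree)
    {B C : Set (Packet m)} (h : ∀ x ∈ B, ∀ y ∈ C, ¬ e.Rel x y) :
    setTest S B * e.toClass S * setTest S C = 0 := by
  classical
  unfold setTest
  rw [Finset.sum_mul, Finset.sum_mul]
  refine Finset.sum_eq_zero fun x hx => ?_
  rw [Finset.mul_sum]
  refine Finset.sum_eq_zero fun y hy => ?_
  exact atom_mul_mul_atom hd hs (h x (by simpa using hx) y (by simpa using hy))

theorem toClass_star_eq (q : Policy m) :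
    q.star.toClass S = 1 + q.toClass S * q.star.toClass S :=
  (Policy.toClass_eq_iff.2 (Provable.ka_unroll_l q)).symm

theorem star_mul_add_eq {q e : Policy m} {r : PolicyClass S m}
    (h : e.toClass S + q.toClass S * r + r = r) : q.star.toClass S * e.toClass S + r = r := by
  induction r using PolicyClass.ind with
  | h r => exact Policy.toClass_eq_iff.2 (.ka_lfp_l (Policy.toClass_eq_iff.1 h))

/-- A safety property of an iteration that holds for the relations is provable, in either
axiomatisation. -/
theorem Provable.mul_star_mul_zero {i q e : Policy m} (hid : i.DupFree) (his : i.StarFree)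
    (hqd : q.DupFree) (hqs : q.StarFree) (hed : e.DupFree) (hes : e.StarFree)
    (h : ∀ x y, ¬ (i * q.star * e).Rel x y) : Provable S (i * q.star * e) 0 := by
  -- The complement of `B` is the invariant: `i` ends inside it, `q` does not leave it, and `e`
  -- drops all of it. These facts become `hi`, `hq` and `he`.
  set B : Set (Packet m) := {x | ∃ y, (q.star * e).Rel x y} with hB
  have hsum := setTest_add_setTest_compl (S := S) B
  have hi : i.toClass S * setTest S B = 0 := by
    have := setTest_mul_mul_setTest (S := S) hid his (B := Set.univ) (C := B) (by
      rintro x - z ⟨y, w, hzw, hwy⟩ hxz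
      exact h x y ⟨w, ⟨z, hxz, hzw⟩, hwy⟩)
    rwa [setTest_univ, one_mul] at this
  have he : setTest S B * e.toClass S = e.toClass S := by
    have := setTest_mul_mul_setTest (S := S) hed hes (B := Bᶜ) (C := Set.univ) (by
      rintro x hx y - hxy
      exact hx ⟨y, x, .refl, hxy⟩)
    rw [setTest_univ, mul_one] at this
    rw [← add_zero (setTest S B * _), ← this, ← add_mul, hsum, one_mul]
  have hq : setTest S B * (q.toClass S * setTest S B) = q.toClass S * setTest S B := by
    have := setTest_mul_mul_setTest (S := S) hqd hqs (B := Bᶜ) (C := B) (by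
      rintro x hx z ⟨y, w, hzw, hwy⟩ hxz
      exact hx ⟨y, w, .head hxz hzw, hwy⟩)
    rw [mul_assoc] at this
    rw [← add_zero (setTest S B * _), ← this, ← add_mul, hsum, one_mul]
  generalize setTest S B = b at *
  generalize setTest S Bᶜ = c at *
  -- The bound for the least-fixed-point rule is `r = b * (q* * e)`: it starts with `b`, which `i`
  -- annihilates. Unrolling the star once and splitting `1 = b + c` after `q` exhibits `e + q * r`
  -- as a summand of `r`.
  have hr : b * (q.star.toClass S * e.toClass S) =
      (e.toClass S + q.toClass S * (b * (q.star.toClass S * e.toClass S))) +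
        b * (q.toClass S * (c * (q.star.toClass S * e.toClass S))) := by
    conv_lhs => rw [toClass_star_eq, add_mul, one_mul, mul_add, he, ← one_mul (q.star.toClass S),
      ← hsum, mul_assoc, mul_assoc, add_mul, mul_add, mul_add]
    rw [← add_assoc, ← mul_assoc (q.toClass S) b, ← mul_assoc b, hq]
  have hle := star_mul_add_eq (S := S) (q := q) (e := e)
    (r := b * (q.star.toClass S * e.toClass S)) (by
      generalize e.toClass S + q.toClass S * (b * (q.star.toClass S * e.toClass S)) = u at *
      rw [hr, ← add_assoc, PolicyClass.add_self])
  -- From `q* * e ≤ r`, multiplying by `i` gives `i * q* * e ≤ i * r = 0`.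
  have hfin := congrArg (i.toClass S * ·) hle
  simp only [mul_add] at hfin
  rw [← mul_assoc _ b, hi, zero_mul, add_zero, ← mul_assoc] at hfin
  exact Policy.toClass_eq_iff.1 hfin

end Quotient

/-! ### Iteration through powers -/

section Powers

variable {k : ℕ} {m : Fin k → ℕ}

theorem Policy.dupFree_pow {q : Policy m} (h : q.DupFree) : ∀ n : ℕ, (q ^ n).DupFree
  | 0 => trivial
  | n + 1 => ⟨h, Policy.dupFree_pow h n⟩

theorem Policy.starFree_pow {q : Policy m} (h : q.StarFree) : ∀ n : ℕ, (q ^ n).StarFree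
  | 0 => trivial
  | n + 1 => ⟨h, Policy.starFree_pow h n⟩

/-- A path of `n` steps of `q` takes the summand `q` in each factor of the `n`-th power; conversely,
factors where `1` is taken add no step. -/
theorem Policy.rel_star_iff_exists_pow (q : Policy m) (x y : Packet m) :
    q.star.Rel x y ↔ ∃ n : ℕ, ((1 + q) ^ n).Rel x y := by
  constructor
  · intro h
    rw [Policy.rel_star] at h
    induction h using Relation.ReflTransGen.head_induction_on with
    | refl => exact ⟨0, rfl⟩
    | head h _ ih =>
      obtain ⟨n, hn⟩ := ih
      exact ⟨n + 1, _, Or.inr h, hn⟩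
  · rintro ⟨n, hn⟩
    induction n generalizing x with
    | zero => obtain rfl : x = y := hn; exact .refl
    | succ n ih =>
      obtain ⟨z, rfl | hz, hn⟩ := hn
      · exact ih _ hn
      · exact .head hz (ih _ hn)

end Powers

end NetKAT

theorem corollary1 {k : ℕ} {m : Fin k → ℕ} (t p ingress egress : NetKAT.Policy m)
    (ht : t.DupFree ∧ t.StarFree) (hp : p.DupFree ∧ p.StarFree)
    (hin : ingress.DupFree ∧ ingress.StarFree) (hout : egress.DupFree ∧ egress.StarFree) :
    NetKAT.Provable NetKAT.EqSystem.full (ingress * (p * t).star * egress) 0 ↔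
      ∀ n : ℕ, NetKAT.Provable NetKAT.EqSystem.safety (ingress * (1 + p * t) ^ n * egress) 0 := by
  constructor
  · intro h n
    have hd : (1 + p * t).DupFree := show True ∧ p.DupFree ∧ t.DupFree from ⟨trivial, hp.1, ht.1⟩
    have hs : (1 + p * t).StarFree :=
      show True ∧ p.StarFree ∧ t.StarFree from ⟨trivial, hp.2, ht.2⟩
    refine NetKAT.Provable.zero_of_rel_empty (e := ingress * (1 + p * t) ^ n * egress)
      ⟨⟨hin.1, NetKAT.Policy.dupFree_pow hd n⟩, hout.1⟩
      ⟨⟨hin.2, NetKAT.Policy.starFree_pow hs n⟩, hout.2⟩ ?_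
    rintro x y ⟨z, ⟨w, hw, hwz⟩, hz⟩
    exact (h.rel_iff x y).1
      ⟨z, ⟨w, hw, ((p * t).rel_star_iff_exists_pow w z).2 ⟨n, hwz⟩⟩, hz⟩
  · intro h
    refine NetKAT.Provable.mul_star_mul_zero hin.1 hin.2 ⟨hp.1, ht.1⟩ ⟨hp.2, ht.2⟩
      hout.1 hout.2 ?_
    rintro x y ⟨z, ⟨w, hw, hwz⟩, hz⟩
    obtain ⟨n, hn⟩ := ((p * t).rel_star_iff_exists_pow w z).1 hwz
    exact ((h n).rel_iff x y).1 ⟨z, ⟨w, hw, hn⟩, hz⟩
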